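/- Let $(b_n)_{n\ge 0}$ be the Baum--Sweet sequence: $b_n=0$ if the binary expansion of $n$ (without leading zeros) contains a block, i.e. a maximal run of consecutive digits $0$, of odd length, and $b_n=1$ otherwise; in particular $b_0=1$. Let $(l_n)_{n\ge 0}$ be the increasing sequence with $\{l_n : n\ge 0\}=\{m\ge 0 : b_m=1\}$. For an integer $k\ge 2$, a sequence of integers $(u_n)_{n\ge 0}$ is called $k$-regular if there are finitely many integer sequences $(s^{(1)}_n)_{n\ge 0},\dots,(s^{(m)}_n)_{n\ge 0}$ such that for all integers $i\ge 0$ and $0\le j<k^i$ there exist $a_1,\dots,a_m\in\mathbb{Z}$ with $u_{k^i n+j}=\sum_{r=1}^m a_r s^{(r)}_n$ for all $n\ge 0$. Then $(l_n)_{n\ge 0}$ is not $k$-regular for any integer $k\ge 2$. -/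

import Mathlib

/-- `HasZeroBlock n r`: the binary expansion of `n` contains a block of `0`'s of length exactly `r`,
that is, `r ≥ 1` consecutive digits `0` which cannot be extended to the left or to the right.
`Nat.digits 2 n` has no leading zeros, and it is empty for `n = 0`. -/
def HasZeroBlock (n r : ℕ) : Prop :=
  1 ≤ r ∧ ∃ u v : List ℕ, Nat.digits 2 n = u ++ List.replicate r 0 ++ v ∧
    u.getLast? ≠ some 0 ∧ v.head? ≠ some 0

open Classical in
/-- The Baum–Sweet sequence `b_n`: it is `0` if the binary expansion of `n` contains a block of
`0`'s of odd length, and `1` otherwise; in particular `b_0 = 1`. -/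
noncomputable def baumSweet (n : ℕ) : ℕ :=
  if ∃ r, Odd r ∧ HasZeroBlock n r then 0 else 1

/-- The sequence `l_n`: the increasing enumeration of the indices `m` with `b_m = 1`. -/
noncomputable def baumSweetOnes (n : ℕ) : ℕ :=
  Nat.nth (fun m => baumSweet m = 1) n

theorem baumSweet_ones_infinite : {m : ℕ | baumSweet m = 1}.Infinite := by
  have key : ∀ n : ℕ, ∃ m, n ≤ m ∧ ∀ d ∈ Nat.digits 2 m, d ≠ 0 := by
    intro n
    induction n with
    | zero => exact ⟨0, le_rfl, by simp⟩
    | succ n ih =>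
      obtain ⟨m, hm, hd⟩ := ih
      refine ⟨1 + 2 * m, by omega, ?_⟩
      rw [Nat.digits_add 2 (by norm_num) 1 m (by norm_num) (by simp)]
      intro d hmem
      rcases List.mem_cons.1 hmem with h | h
      · omega
      · exact hd d h
  rw [Set.infinite_iff_exists_gt]
  intro n
  obtain ⟨m, hm, hd⟩ := key (n + 1)
  refine ⟨m, ?_, by omega⟩
  have : ¬ ∃ r, Odd r ∧ HasZeroBlock m r := by
    rintro ⟨r, -, hr, u, v, h, -, -⟩
    refine hd 0 ?_ rfl
    rw [h]
    simp
    omega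
  exact if_neg this

/-- `baumSweetOnes` is indeed increasing. -/
theorem baumSweetOnes_strictMono : StrictMono baumSweetOnes :=
  Nat.nth_strictMono baumSweet_ones_infinite

/-- `baumSweetOnes` indeed takes exactly the values `m` with `b_m = 1`. -/
theorem range_baumSweetOnes : Set.range baumSweetOnes = {m : ℕ | baumSweet m = 1} :=
  Nat.range_nth_of_infinite baumSweet_ones_infinite

/-- The `k`-kernel of a sequence: all subsequences `n ↦ u (k ^ i * n + j)` with `j < k ^ i`. -/
def seqKernel {M : Type*} (k : ℕ) (u : ℕ → M) : Set (ℕ → M) :=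
  {w | ∃ i j : ℕ, j < k ^ i ∧ w = fun n => u (k ^ i * n + j)}

/-- A sequence with values in a `ℤ`-module `M` is `k`-regular (a notion meant for `k ≥ 2`) if there
are finitely many sequences in `M` such that every member of the `k`-kernel is a `ℤ`-linear
combination of them. -/
def IsKRegular {M : Type*} [AddCommGroup M] (k : ℕ) (u : ℕ → M) : Prop :=
  ∃ (m : ℕ) (s : Fin m → ℕ → M), ∀ w ∈ seqKernel k u,
    ∃ a : Fin m → ℤ, ∀ n : ℕ, w n = ∑ r, a r • s r n

/-! The obstruction is the frequency of odd terms. Modulo 2, a k-regular sequence has a finite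
k-kernel; the averages of its members over [0, k^N) form an orbit of one rational matrix, so by
Cayley–Hamilton they satisfy a rational linear recurrence and any limit is rational
(`exists_rat_eq_of_tendsto_average_of_finite_decimation`). For l_n the limit is irrational. With A
the counting function of the l_n, stripping a final 1 or 00 gives A(x) ≈ A(x/2) + A(x/4)
(`baumSweetCount_eq_add`). The odd terms below x number A(⌊x/2⌋), and A(⌊x/2⌋)/A(x) tends to (√5 -
1)/2 = `-goldenConj`. -/

/-- Some maximal run of `0`'s in the list `L` has odd length. -/
def HasOddZeroRun (L : List ℕ) : Prop :=
  ∃ r, Odd r ∧ ∃ u v : List ℕ, L = u ++ List.replicate r 0 ++ v ∧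
    u.getLast? ≠ some 0 ∧ v.head? ≠ some 0

theorem baumSweet_eq_one_iff (n : ℕ) :
    baumSweet n = 1 ↔ ¬ HasOddZeroRun (Nat.digits 2 n) := by
  have h : (∃ r, Odd r ∧ HasZeroBlock n r) ↔ HasOddZeroRun (Nat.digits 2 n) :=
    ⟨fun ⟨r, hr, _, h⟩ => ⟨r, hr, h⟩, fun ⟨r, hr, h⟩ => ⟨r, hr, hr.pos, h⟩⟩
  rw [← h]
  unfold baumSweet
  split_ifs with h' <;> simp [h']

theorem hasOddZeroRun_one_cons (L : List ℕ) : HasOddZeroRun (1 :: L) ↔ HasOddZeroRun L := by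
  constructor
  · rintro ⟨r, hr, u, v, h, hu, hv⟩
    cases u with
    | nil =>
      obtain ⟨s, rfl⟩ := Nat.exists_eq_succ_of_ne_zero hr.pos.ne'
      simp [List.replicate_succ] at h
    | cons a u =>
      simp only [List.cons_append, List.cons.injEq] at h
      refine ⟨r, hr, u, v, h.2, ?_, hv⟩
      cases u with
      | nil => simp
      | cons b u => simpa [List.getLast?_cons_cons] using hu
  · rintro ⟨r, hr, u, v, rfl, hu, hv⟩
    refine ⟨r, hr, 1 :: u, v, by simp, ?_, hv⟩
    cases u with
    | nil => simp
    | cons b u => simpa [List.getLast?_cons_cons] using hu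

/-- Only the parity of a run matters. Digits are listed least significant first, so this strips
trailing binary zeros. -/
theorem hasOddZeroRun_zero_zero_cons (L : List ℕ) :
    HasOddZeroRun (0 :: 0 :: L) ↔ HasOddZeroRun L := by
  constructor
  · rintro ⟨r, hr, u, v, h, hu, hv⟩
    match u with
    | [] =>
      match r with
      | 0 => simp at hr
      | 1 =>
        simp only [List.replicate_one, List.nil_append, List.cons_append, List.cons.injEq,
          true_and] at h
        simp [← h] at hv
      | r + 2 =>
        refine ⟨r, by simpa [Nat.odd_add] using hr, [], v, ?_, by simp, hv⟩
        simpa [List.replicate_succ] using h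
    | [a] =>
      simp only [List.cons_append, List.cons.injEq] at h
      simp [← h.1] at hu
    | [a, b] =>
      simp only [List.cons_append, List.cons.injEq] at h
      simp [← h.2.1] at hu
    | a :: b :: c :: u =>
      simp only [List.cons_append, List.cons.injEq] at h
      exact ⟨r, hr, c :: u, v, by simpa using h.2.2,
        by simpa [List.getLast?_cons_cons] using hu, hv⟩
  · rintro ⟨r, hr, u, v, rfl, hu, hv⟩
    cases u with
    | nil => exact ⟨r + 2, by simpa [Nat.odd_add] using hr, [], v,
        by simp [List.replicate_succ], by simp, hv⟩
    | cons b u => exact ⟨r, hr, 0 :: 0 :: b :: u, v, by simp,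
        by simpa [List.getLast?_cons_cons] using hu, hv⟩

theorem baumSweet_two_mul_add_one (m : ℕ) : baumSweet (2 * m + 1) = 1 ↔ baumSweet m = 1 := by
  rw [baumSweet_eq_one_iff, baumSweet_eq_one_iff, add_comm,
    Nat.digits_add 2 (by norm_num) 1 m (by norm_num) (by simp), hasOddZeroRun_one_cons]

theorem baumSweet_four_mul (m : ℕ) : baumSweet (4 * m) = 1 ↔ baumSweet m = 1 := by
  rcases Nat.eq_zero_or_pos m with rfl | hm
  · simp
  rw [baumSweet_eq_one_iff, baumSweet_eq_one_iff, show 4 * m = 0 + 2 * (0 + 2 * m) by ring,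
    Nat.digits_add 2 (by norm_num) 0 _ (by norm_num) (by omega),
    Nat.digits_add 2 (by norm_num) 0 _ (by norm_num) (by omega), hasOddZeroRun_zero_zero_cons]

theorem baumSweet_four_mul_add_two (m : ℕ) : baumSweet (4 * m + 2) ≠ 1 := by
  rw [Ne, baumSweet_eq_one_iff, not_not, show 4 * m + 2 = 0 + 2 * (1 + 2 * m) by ring,
    Nat.digits_add 2 (by norm_num) 0 _ (by norm_num) (by omega),
    Nat.digits_add 2 (by norm_num) 1 _ (by norm_num) (by omega)]
  exact ⟨1, odd_one, [], 1 :: Nat.digits 2 m, by simp, by simp, by simp⟩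

/-! ### Counting function and density of odd terms -/

/-- The number of `m < x` with `b_m = 1`. -/
noncomputable def baumSweetCount (x : ℕ) : ℕ :=
  Nat.count (fun m => baumSweet m = 1) x

theorem baumSweetCount_succ (x : ℕ) :
    baumSweetCount (x + 1) = baumSweetCount x + if baumSweet x = 1 then 1 else 0 :=
  Nat.count_succ _ _

theorem baumSweetCount_mono : Monotone baumSweetCount := Nat.count_monotone _

/-- The terms are the 2m+1 and the 4m with b_m = 1; 2m+1 < x means m < ⌊x/2⌋, and 4m < x means m <
⌈x/4⌉. -/
theorem baumSweetCount_eq_add (x : ℕ) :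
    baumSweetCount x = baumSweetCount (x / 2) + baumSweetCount ((x + 3) / 4) := by
  induction x with
  | zero => simp [baumSweetCount]
  | succ x ih =>
    rw [baumSweetCount_succ, ih]
    obtain ⟨m, hm | hm | hm⟩ : ∃ m, x = 2 * m + 1 ∨ x = 4 * m ∨ x = 4 * m + 2 := by
      rcases Nat.even_or_odd' x with ⟨c, hc | hc⟩
      · rcases Nat.even_or_odd' c with ⟨d, hd | hd⟩
        · exact ⟨d, by omega⟩
        · exact ⟨d, by omega⟩
      · exact ⟨c, by omega⟩
    · rw [show (x + 1) / 2 = m + 1 by omega, show x / 2 = m by omega,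
        show (x + 1 + 3) / 4 = (x + 3) / 4 by omega, baumSweetCount_succ m, hm]
      simp only [baumSweet_two_mul_add_one]
      ring
    · rw [show (x + 1) / 2 = x / 2 by omega, show (x + 1 + 3) / 4 = m + 1 by omega,
        show (x + 3) / 4 = m by omega, baumSweetCount_succ m, hm]
      simp only [baumSweet_four_mul]
      ring
    · rw [show (x + 1) / 2 = x / 2 by omega, show (x + 1 + 3) / 4 = (x + 3) / 4 by omega, hm]
      simp [baumSweet_four_mul_add_two]

theorem sum_baumSweetOnes_mod_two (x : ℕ) :
    ∑ i ∈ Finset.range (baumSweetCount x), baumSweetOnes i % 2 = baumSweetCount (x / 2) := by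
  induction x with
  | zero => simp [baumSweetCount]
  | succ x ih =>
    rw [baumSweetCount_succ]
    by_cases hx : baumSweet x = 1
    · rw [if_pos hx, Finset.sum_range_succ, ih,
        show baumSweetOnes (baumSweetCount x) = x from Nat.nth_count hx]
      rcases Nat.even_or_odd' x with ⟨c, hc | hc⟩
      · rw [show (x + 1) / 2 = x / 2 by omega]
        omega
      · rw [hc, baumSweet_two_mul_add_one] at hx
        rw [show (x + 1) / 2 = c + 1 by omega, show x / 2 = c by omega, baumSweetCount_succ,
          if_pos hx]
        omega
    · rw [if_neg hx, add_zero, ih]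
      rcases Nat.even_or_odd' x with ⟨c, hc | hc⟩
      · rw [show (x + 1) / 2 = x / 2 by omega]
      · rw [hc, baumSweet_two_mul_add_one] at hx
        rw [show (x + 1) / 2 = c + 1 by omega, show x / 2 = c by omega, baumSweetCount_succ,
          if_neg hx, add_zero]

open Real in
theorem exists_abs_baumSweetCount_half_sub_le :
    ∃ C : ℝ, ∀ x : ℕ,
      |(baumSweetCount (x / 2) : ℝ) - (-goldenConj) * baumSweetCount x| ≤ C := by
  have h0 : 0 < -goldenConj := by linarith [goldenConj_neg]
  have h1 : 0 < 1 + goldenConj := by linarith [neg_one_lt_goldenConj]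
  -- With γ = `-goldenConj`, this is the fixed point of C ↦ γ(C + 1), matching the error recursion
  -- `hD`.
  refine ⟨(-goldenConj) / (1 + goldenConj), fun x => ?_⟩
  have hC : 0 ≤ (-goldenConj) / (1 + goldenConj) := by positivity
  have hC' : (-goldenConj) * ((-goldenConj) / (1 + goldenConj)) + (-goldenConj)
      = (-goldenConj) / (1 + goldenConj) := by
    rw [eq_div_iff h1.ne', add_mul, mul_assoc, div_mul_cancel₀ _ h1.ne']
    ring
  induction x using Nat.strong_induction_on with
  | _ x ih =>
    rcases Nat.eq_zero_or_pos x with rfl | hx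
    · simpa [baumSweetCount] using hC
    have key := ih (x / 2) (by omega)
    -- `e` is the cost of replacing ⌈x/4⌉ by ⌊x/4⌋.
    obtain ⟨e, he0, he1, he⟩ : ∃ e : ℝ, 0 ≤ e ∧ e ≤ 1 ∧
        (baumSweetCount x : ℝ) = baumSweetCount (x / 2) + baumSweetCount (x / 2 / 2) + e := by
      have hq := baumSweetCount_eq_add x
      have hlo : baumSweetCount (x / 2 / 2) ≤ baumSweetCount ((x + 3) / 4) :=
        baumSweetCount_mono (by omega)
      have hhi : baumSweetCount ((x + 3) / 4) ≤ baumSweetCount (x / 2 / 2) + 1 := by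
        refine (baumSweetCount_mono (show (x + 3) / 4 ≤ x / 2 / 2 + 1 by omega)).trans ?_
        rw [baumSweetCount_succ]
        split_ifs <;> omega
      have hq' : (baumSweetCount x : ℝ)
          = baumSweetCount (x / 2) + baumSweetCount ((x + 3) / 4) := by exact_mod_cast hq
      have hlo' : (baumSweetCount (x / 2 / 2) : ℝ) ≤ baumSweetCount ((x + 3) / 4) := by
        exact_mod_cast hlo
      have hhi' : (baumSweetCount ((x + 3) / 4) : ℝ) ≤ baumSweetCount (x / 2 / 2) + 1 := by
        exact_mod_cast hhi
      exact ⟨baumSweetCount ((x + 3) / 4) - baumSweetCount (x / 2 / 2), by linarith,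
        by linarith, by linarith⟩
    have hD : (baumSweetCount (x / 2) : ℝ) - (-goldenConj) * baumSweetCount x
        = goldenConj * ((baumSweetCount (x / 2 / 2) - (-goldenConj) * baumSweetCount (x / 2)) + e)
        := by
      rw [he]
      linear_combination (-(baumSweetCount (x / 2) : ℝ)) * goldenConj_sq
    rw [hD, abs_mul, abs_of_neg goldenConj_neg, ← hC', ← mul_add_one]
    refine mul_le_mul_of_nonneg_left ((abs_add_le _ _).trans ?_) h0.le
    rw [abs_of_nonneg he0]
    exact add_le_add key he1

open Filter Topology in
theorem tendsto_average_baumSweetOnes_mod_two :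
    Tendsto (fun N : ℕ => (∑ i ∈ Finset.range N, ((baumSweetOnes i % 2 : ℕ) : ℝ)) / N)
      atTop (𝓝 (-Real.goldenConj)) := by
  obtain ⟨C, hC⟩ := exists_abs_baumSweetCount_half_sub_le
  rw [tendsto_iff_norm_sub_tendsto_zero]
  refine squeeze_zero' (Eventually.of_forall fun _ => norm_nonneg _) ?_
    (tendsto_const_div_atTop_nhds_zero_nat C)
  filter_upwards [eventually_gt_atTop 0] with N hN
  have hN' : (0 : ℝ) < N := by exact_mod_cast hN
  have hcount : baumSweetCount (baumSweetOnes N) = N :=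
    Nat.count_nth_of_infinite baumSweet_ones_infinite N
  have hs := sum_baumSweetOnes_mod_two (baumSweetOnes N)
  have h := hC (baumSweetOnes N)
  rw [← hs, hcount] at h
  push_cast at h
  rw [Real.norm_eq_abs, div_sub' hN'.ne', abs_div, abs_of_pos hN', mul_comm (N : ℝ)]
  gcongr

/-! ### Rationality of limits and densities -/

/-- The shift operator on rational sequences. -/
def seqShift : Module.End ℚ (ℕ → ℚ) := LinearMap.funLeft ℚ ℚ Nat.succ

theorem seqShift_apply (x : ℕ → ℚ) (n : ℕ) : seqShift x n = x (n + 1) := rfl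

open Filter Topology Polynomial in
theorem tendsto_aeval_seqShift {x : ℕ → ℚ} {d : ℝ}
    (hx : Tendsto (fun n => (x n : ℝ)) atTop (𝓝 d)) (P : ℚ[X]) :
    Tendsto (fun n => (aeval seqShift P x n : ℝ)) atTop (𝓝 ((P.eval 1 : ℚ) * d)) := by
  induction P using Polynomial.induction_on' with
  | add p q hp hq =>
    simpa [add_mul] using hp.add hq
  | monomial m a =>
    have hpow : ∀ m n, ((seqShift ^ m) x) n = x (n + m) := by
      intro m
      induction m with
      | zero => simp
      | succ m ih =>
        intro n
        rw [pow_succ', Module.End.mul_apply, seqShift_apply, ih, add_right_comm, add_assoc]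
    simpa [aeval_monomial, hpow] using
      (((tendsto_add_atTop_iff_nat m).2 hx).const_mul (a : ℝ))

open Filter Topology Polynomial in
/-- The limit of a convergent rational sequence that satisfies a linear recurrence with rational
coefficients is rational. -/
theorem exists_rat_eq_of_tendsto_of_aeval_seqShift {x : ℕ → ℚ} {d : ℝ}
    (hx : Tendsto (fun n => (x n : ℝ)) atTop (𝓝 d)) (P : ℚ[X]) (hP : P ≠ 0)
    (h : aeval seqShift P x = 0) : ∃ q : ℚ, (q : ℝ) = d := by
  induction hn : P.natDegree using Nat.strong_induction_on generalizing P with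
  | _ n ih =>
    have hlim := tendsto_aeval_seqShift hx P
    simp only [h, Pi.zero_apply, Rat.cast_zero] at hlim
    have h0 := tendsto_nhds_unique hlim tendsto_const_nhds
    rcases mul_eq_zero.1 h0 with hP1 | hd
    swap
    · exact ⟨0, by simp [hd]⟩
    -- Write P = (X - 1)Q: then Q(shift)x is constant, which either determines d or, if Q(1) = 0,
    -- vanishes and allows descent to Q.
    have hroot : P.IsRoot 1 := by exact_mod_cast hP1
    obtain ⟨Q, rfl⟩ := dvd_iff_isRoot.2 hroot
    have hQ : Q ≠ 0 := right_ne_zero_of_mul hP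
    have hconst : ∀ n, aeval seqShift Q x n = aeval seqShift Q x 0 := by
      intro n
      induction n with
      | zero => rfl
      | succ n ihn =>
        have := congrFun h n
        rw [map_mul, Module.End.mul_apply] at this
        simp only [map_sub, aeval_X, map_one, LinearMap.sub_apply, Module.End.one_apply,
          Pi.sub_apply, seqShift_apply, Pi.zero_apply] at this
        linarith
    have hlimQ := tendsto_aeval_seqShift hx Q
    simp only [hconst] at hlimQ
    have hq := tendsto_nhds_unique tendsto_const_nhds hlimQ
    by_cases hQ1 : Q.eval 1 = 0
    · have hz : aeval seqShift Q x = 0 := by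
        funext n
        rw [hconst]
        rw [hQ1] at hq
        simpa using hq
      refine ih Q.natDegree ?_ Q hQ hz rfl
      rw [← hn, natDegree_mul (X_sub_C_ne_zero 1) hQ, natDegree_X_sub_C]
      omega
    · refine ⟨aeval seqShift Q x 0 / Q.eval 1, ?_⟩
      have : ((Q.eval 1 : ℚ) : ℝ) ≠ 0 := by exact_mod_cast hQ1
      push_cast
      rw [hq]
      field_simp

theorem sum_range_mul_eq_sum_sum (k N : ℕ) (g : ℕ → ℚ) :
    ∑ t ∈ Finset.range (k * N), g t
      = ∑ j ∈ Finset.range k, ∑ t ∈ Finset.range N, g (k * t + j) := by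
  rw [Finset.sum_comm]
  induction N with
  | zero => simp
  | succ N ih => rw [Nat.mul_succ, Finset.sum_range_add, ih, Finset.sum_range_succ]

open Filter Topology Polynomial in
/-- A density along powers of `k` of a sequence that belongs to a finite family closed under
`k`-decimation is rational. -/
theorem exists_rat_eq_of_tendsto_average_of_finite_decimation {ι : Type*} [Finite ι] {k : ℕ}
    (f : ι → ℕ → ℚ) (τ : ι → ℕ → ι)
    (hτ : ∀ i, ∀ j < k, ∀ n, f i (k * n + j) = f (τ i j) n) (i : ι) {d : ℝ}
    (hd : Tendsto (fun N => (((∑ t ∈ Finset.range (k ^ N), f i t) / (k : ℚ) ^ N : ℚ) : ℝ))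
      atTop (𝓝 d)) : ∃ q : ℚ, (q : ℝ) = d := by
  classical
  cases nonempty_fintype ι
  let X : ℕ → ι → ℚ := fun N i => (∑ t ∈ Finset.range (k ^ N), f i t) / (k : ℚ) ^ N
  -- Splitting [0, k^(N+1)) by residue mod k makes `M` advance the averages by one step.
  let M : Module.End ℚ (ι → ℚ) :=
    LinearMap.pi fun i => (k : ℚ)⁻¹ • ∑ j ∈ Finset.range k, LinearMap.proj (τ i j)
  have hM : ∀ N, M (X N) = X (N + 1) := by
    intro N
    funext i
    simp only [M, X, LinearMap.pi_apply, LinearMap.smul_apply, LinearMap.sum_apply,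
      LinearMap.proj_apply, smul_eq_mul]
    rw [pow_succ' k N, sum_range_mul_eq_sum_sum, ← Finset.sum_div, pow_succ' (k : ℚ) N,
      mul_comm (k : ℚ), ← div_div, div_eq_mul_inv _ (k : ℚ), mul_comm]
    congr 2
    exact Finset.sum_congr rfl fun j hj => Finset.sum_congr rfl fun t _ =>
      (hτ i j (Finset.mem_range.1 hj) t).symm
  have hP : ∀ (P : ℚ[X]) (N : ℕ), aeval seqShift P (fun N => X N i) N = aeval M P (X N) i := by
    intro P
    induction P using Polynomial.induction_on' with
    | add p q hp hq => intro N; simp [hp, hq]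
    | monomial m a =>
      have h1 : ∀ m N, (seqShift ^ m) (fun N => X N i) N = X (N + m) i := by
        intro m
        induction m with
        | zero => simp
        | succ m ih =>
          intro N
          rw [pow_succ', Module.End.mul_apply, seqShift_apply, ih, add_right_comm, add_assoc]
      have h2 : ∀ m N, (M ^ m) (X N) = X (N + m) := by
        intro m
        induction m with
        | zero => simp
        | succ m ih =>
          intro N
          rw [pow_succ', Module.End.mul_apply, ih, hM, add_assoc]
      intro N
      simp [aeval_monomial, h1, h2]
  refine exists_rat_eq_of_tendsto_of_aeval_seqShift (x := fun N => X N i) hd M.charpoly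
    M.charpoly_monic.ne_zero ?_
  funext N
  rw [hP, LinearMap.aeval_self_charpoly]
  rfl

/-! ### Kernels and conclusion -/

theorem mem_seqKernel_self {M : Type*} (k : ℕ) (u : ℕ → M) : u ∈ seqKernel k u :=
  ⟨0, 0, by simp, by simp⟩

theorem decimation_mem_seqKernel {M : Type*} {k : ℕ} {u w : ℕ → M} (hw : w ∈ seqKernel k u)
    {j : ℕ} (hj : j < k) : (fun n => w (k * n + j)) ∈ seqKernel k u := by
  obtain ⟨i, j', hj', rfl⟩ := hw
  refine ⟨i + 1, k ^ i * j + j', ?_, ?_⟩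
  · calc k ^ i * j + j' < k ^ i * j + k ^ i := by omega
      _ = k ^ i * (j + 1) := by ring
      _ ≤ k ^ i * k := Nat.mul_le_mul_left _ hj
      _ = k ^ (i + 1) := by ring
  · funext n
    exact congrArg u (by ring)

/-- The reduction of a `k`-regular integer sequence modulo `N` is `k`-automatic. -/
theorem IsKRegular.finite_seqKernel_intCast {k : ℕ} {u : ℕ → ℤ} (h : IsKRegular k u) (N : ℕ)
    [NeZero N] : (seqKernel k fun n => (u n : ZMod N)).Finite := by
  obtain ⟨m, s, hs⟩ := h
  refine (Set.finite_range fun (a : Fin m → ZMod N) (n : ℕ) =>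
    ∑ r, a r * (s r n : ZMod N)).subset ?_
  rintro w ⟨i, j, hj, rfl⟩
  obtain ⟨a, ha⟩ := hs _ ⟨i, j, hj, rfl⟩
  refine ⟨fun r => (a r : ZMod N), ?_⟩
  funext n
  have := congrArg (Int.cast : ℤ → ZMod N) (ha n)
  simpa using this.symm

theorem mainTheorem1 (k : ℕ) (hk : 2 ≤ k) :
    ¬ IsKRegular k (fun n : ℕ => (baumSweetOnes n : ℤ)) := by
  intro h
  set K := seqKernel k fun n => ((baumSweetOnes n : ℤ) : ZMod 2)
  have : Finite K := (h.finite_seqKernel_intCast 2).to_subtype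
  have hkpos : 0 < k := by omega
  obtain ⟨q, hq⟩ := exists_rat_eq_of_tendsto_average_of_finite_decimation (ι := K) (k := k)
    (fun w n => ((w.1 n).val : ℚ))
    -- Taking `j % k` keeps the map inside the kernel for every `j`.
    (fun w j => ⟨fun n => w.1 (k * n + j % k),
      decimation_mem_seqKernel w.2 (Nat.mod_lt _ hkpos)⟩)
    (fun w j hj n => by simp only [Nat.mod_eq_of_lt hj])
    ⟨_, mem_seqKernel_self k _⟩ (d := -Real.goldenConj) (by
      refine (tendsto_average_baumSweetOnes_mod_two.comp
        (tendsto_pow_atTop_atTop_of_one_lt (r := k) (by omega))).congr fun N => ?_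
      simp [ZMod.val_natCast])
  exact Real.goldenConj_irrational.neg ⟨q, hq⟩
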